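/- **Setting.** Let $V$ be a set with a locally finite $n$-dimensional abstract simplicial complex structure: a set $V^n$ of facets, which are ordered sequences $\beta=(v_0,\dots,v_n)$ of pairwise distinct elements of $V$, such that every $v\in V$ belongs to finitely many facets. Write $\pi_i(\beta)=v_i$. Let $G$ be a (finite-dimensional) Lie group, $H\subseteq G$ a closed subgroup, and $P_d=(P_v)_{v\in V}$ a discrete principal $G$-bundle, i.e. each $P_v$ is a manifold with a left $G$-action that is equivariantly diffeomorphic to $G$ acting on itself by left translations. For $v,w\in V$, a pair $(p,\tilde p)\in P_v\times P_w$ determines the unique $G$-equivariant map $p^{-1}\tilde p\colon P_v\to P_w$ sending $p$ to $\tilde p$; in this way $(P_v\times P_w)/G$ is the manifold $\mathrm{End}(P_v,P_w)$ of all $G$-equivariant maps $P_v\to P_w$. Let $\mathrm{Str}_{H,v}=P_v/H$, and for a facet $\beta=(v_0,\dots,v_n)$ put $$JP_\beta=P_{v_0}\times\dots\times P_{v_n},\qquad RJP_\beta=\mathrm{Str}_{H,v_0}\times\prod_{k=1}^n\mathrm{End}(P_{v_0},P_{v_k}),$$ $$\pi^H\colon JP_\beta\to RJP_\beta,\qquad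 \pi^H(p_0,\dots,p_n)=(Hp_0,\;p_0^{-1}p_1,\dots,p_0^{-1}p_n).$$ Let $\mathrm{Ad}P_v$ be the vector space of $G$-invariant vector fields on $P_v$ and $\mathrm{Ad}^*P_v$ its dual; evaluation at a point $p\in P_v$ identifies $\mathrm{Ad}P_v\simeq T_pP_v$. For a $G$-equivariant map $\psi\colon P_v\to P_w$ let $\mathrm{Ad}_\psi\colon\mathrm{Ad}P_v\to\mathrm{Ad}P_w$ be the induced map on invariant vector fields and $\mathrm{Ad}^*_\psi\colon \mathrm{Ad}^*P_v\to\mathrm{Ad}^*P_w$ the transpose of $\mathrm{Ad}_{\psi^{-1}}$. For a smooth function $\bar\ell_\beta$ on $RJP_\beta$ and $r=(q_0,\psi_1,\dots,\psi_n)\in RJP_\beta$, the components $\partial^0_r\bar\ell_\beta,\partial^{01}_r\bar\ell_\beta,\dots,\partial^{0n}_r\bar\ell_\beta\in\mathrm{Ad}^*P_{v_0}$ of its differential are defined as follows. For $A\in\mathrm{Ad}P_{v_0}$, any $p\in q_0$ and any curve $p(t)$ in $P_{v_0}$ with $p(0)=p$, $\dot p(0)=A(p)$, $$\langle\partial^0_r\bar\ell_\beta,A\rangle=\tfrac{d}{dt}\Big|_0\bar\ell_\beta(Hp(t),\psi_1,\dots,\psi_n),\qquad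 \langle\partial^{0i}_r\bar\ell_\beta,A\rangle=\tfrac{d}{dt}\Big|_0\bar\ell_\beta\big(q_0,\psi_1,\dots,p(t)^{-1}\psi_i(p),\dots,\psi_n\big)$$ (these do not depend on the choice of $p$ and of the curve). For a discrete Lagrangian $L_d=(L_\beta\colon JP_\beta\to\mathbb R)_{\beta\in V^n}$ and a discrete field $p_d=(p_v)_{v\in V}$, $p_v\in P_v$, the discrete Euler–Lagrange tensor at $v$ is $$\mathcal{EL}_{dv}(p_d)=\sum_{\beta\ni v}d^{k(v,\beta)}L_\beta\in T^*_{p_v}P_v ,$$ the sum over all facets $\beta$ containing $v$, where $k(v,\beta)$ is the position of $v$ in $\beta=(v_0,\dots,v_n)$ and $d^kL_\beta$ is the partial differential of $L_\beta$ in its $k$-th variable at $(p_{v_0},\dots,p_{v_n})$. Let $\mathcal{EL}^{\mathrm{Ad}}_{dv}(p_d)\in\mathrm{Ad}^*P_v$ be its image under $T^*_{p_v}P_v\simeq\mathrm{Ad}^*P_v$. **Theorem (discrete Euler–Poincaré tensor).** Let $\bar\ell_d=(\bar\ell_\beta)_{\beta\in V^n}$ be a family of smooth functions $\bar\ell_\beta\colon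 RJP_\beta\to\mathbb R$, and let $L_d=\bar\ell_d\circ\pi^H$. Then for every discrete field $p_d$ and every $v\in V$, $$\mathcal{EL}^{\mathrm{Ad}}_{dv}(p_d)=\sum_{\pi_0(\beta)=v}\partial^0_{r_\beta}\bar\ell_\beta+\sum_{i=1}^n\sum_{\pi_0(\beta)=v}\partial^{0i}_{r_\beta}\bar\ell_\beta-\sum_{i=1}^n\sum_{\pi_i(\beta)=v}\mathrm{Ad}^*_{\psi_{\beta,i}}\,\partial^{0i}_{r_\beta}\bar\ell_\beta\;\in\;\mathrm{Ad}^*P_v,$$ where, for $\beta=(v_0,\dots,v_n)$, $r_\beta=\pi^H(p_{v_0},\dots,p_{v_n})=(Hp_{v_0},\psi_{\beta,1},\dots,\psi_{\beta,n})$ with $\psi_{\beta,i}=p_{v_0}^{-1}p_{v_i}$. -/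

import Mathlib

open scoped Manifold ContDiff

noncomputable section

namespace DiscreteField

/-! ### Abstract simplicial complexes, discrete bundles, discrete Euler-Lagrange tensor -/

/-- An (ordered) `n`-dimensional abstract simplicial complex structure on a set `V`: a set of
sequences `(v₀, …, vₙ)` without repeated terms, called facets. -/
structure SimplicialComplex (n : ℕ) (V : Type*) where
  facets : Set (Fin (n + 1) → V)
  injective_of_mem : ∀ β ∈ facets, Function.Injective β

namespace SimplicialComplex

variable {n : ℕ} {V : Type*} (K : SimplicialComplex n V)

/-- The set of facets having `v` among their vertices. -/
def star (v : V) : Set K.facets := {β | ∃ k, β.1 k = v}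

/-- The set of facets `β` with `π_i(β) = v`. -/
def facetsAt (i : Fin (n + 1)) (v : V) : Set K.facets := {β | β.1 i = v}

/-- The complex is locally finite if the star of any vertex is finite. -/
class LocallyFinite : Prop where
  finite_star : ∀ v, (K.star v).Finite

instance [K.LocallyFinite] (v : V) : Fintype (K.star v) :=
  (LocallyFinite.finite_star (K := K) v).fintype

instance [K.LocallyFinite] (i : Fin (n + 1)) (v : V) : Fintype (K.facetsAt i v) :=
  ((LocallyFinite.finite_star (K := K) v).subset fun _ hβ => ⟨i, hβ⟩).fintype

variable {K}

/-- The position `k(v, β)` of the vertex `v` in a facet `β` of its star (it is unique because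
facets have no repeated vertices). -/
def position {v : V} (β : K.star v) : Fin (n + 1) := β.2.choose

theorem position_spec {v : V} (β : K.star v) : β.1.1 (position β) = v := β.2.choose_spec

end SimplicialComplex

section EulerLagrange

variable {n : ℕ} {V : Type*} {K : SimplicialComplex n V}
variable (E : Type*) [NormedAddCommGroup E] [NormedSpace ℝ E]

/-- The fiber at the facet `β = (v₀, …, vₙ)` of the discrete jet bundle of a discrete bundle
with fibers `Y v`: the product manifold `Y v₀ × … × Y vₙ`. -/
abbrev Jet (Y : V → Type*) (β : Fin (n + 1) → V) : Type _ := ∀ k, Y (β k)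

/-- The jet extension of a discrete field at the facet `β`. -/
def jetExt {Y : V → Type*} (y : ∀ v, Y v) (β : Fin (n + 1) → V) : Jet Y β := fun k => y (β k)

variable {Y : V → Type*} [∀ v, TopologicalSpace (Y v)] [∀ v, ChartedSpace E (Y v)]

/-- The component `d^k L ∈ T*_{y_k} Y_{v_k}` at the jet `(y₀, …, yₙ)` of the differential of a
function `L` on `Y v₀ × … × Y vₙ`, that is, the differential at `y_k` of the function obtained by
fixing all the variables but the `k`-th one. -/
def partialD {β : Fin (n + 1) → V} (L : Jet Y β → ℝ) (y : Jet Y β) (k : Fin (n + 1)) :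
    TangentSpace 𝓘(ℝ, E) (y k) →ₗ[ℝ] ℝ :=
  (mfderiv 𝓘(ℝ, E) 𝓘(ℝ, ℝ) (fun x : Y (β k) => L (Function.update y k x)) (y k)).toLinearMap

/-- The discrete Euler-Lagrange tensor at the vertex `v`: the sum over the facets `β` in the star
of `v` of `d^{k(v, β)} L_β` at the jet extension of `y`. -/
def eulerLagrange [K.LocallyFinite] (L : ∀ β : K.facets, Jet Y β.1 → ℝ) (y : ∀ v, Y v) (v : V) :
    TangentSpace 𝓘(ℝ, E) (y v) →ₗ[ℝ] ℝ :=
  ∑ β : K.star v,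
    Eq.rec (motive := fun u _ => TangentSpace 𝓘(ℝ, E) (y u) →ₗ[ℝ] ℝ)
      (partialD E (L β.1) (jetExt y β.1.1) (SimplicialComplex.position β))
      (SimplicialComplex.position_spec β)

end EulerLagrange

/-! ### Fibers of a discrete principal bundle -/

section Fiber

variable (E : Type*) [NormedAddCommGroup E] [NormedSpace ℝ E]
variable (G : Type*) [Group G] [TopologicalSpace G] [ChartedSpace E G]

/-- A manifold `X` with a left action of the Lie group `G` is a fiber of a principal `G`-bundle
if it is equivariantly diffeomorphic to `G` acting on itself by left multiplication. -/
class IsPrincipalFiber (X : Type*) [TopologicalSpace X] [ChartedSpace E X] [MulAction G X] :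
    Prop where
  exists_trivialization :
    ∃ Φ : G ≃ₘ^∞⟮𝓘(ℝ, E), 𝓘(ℝ, E)⟯ X, ∀ g h : G, Φ (g * h) = g • Φ h

section Torsor

variable {G}
variable {X Y : Type*}
  [TopologicalSpace X] [ChartedSpace E X] [MulAction G X] [IsPrincipalFiber E G X]
  [TopologicalSpace Y] [ChartedSpace E Y] [MulAction G Y] [IsPrincipalFiber E G Y]

theorem existsUnique_smul_eq (E : Type*) [NormedAddCommGroup E] [NormedSpace ℝ E]
    {G : Type*} [Group G] [TopologicalSpace G] [ChartedSpace E G]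
    {X : Type*} [TopologicalSpace X] [ChartedSpace E X] [MulAction G X] [IsPrincipalFiber E G X]
    (x y : X) : ∃! g : G, g • x = y := by
  obtain ⟨Φ, hΦ⟩ := IsPrincipalFiber.exists_trivialization (E := E) (G := G) (X := X)
  have key : ∀ g : G, g • x = Φ (g * Φ.symm x) := fun g => by rw [hΦ]; simp
  refine ⟨Φ.symm y * (Φ.symm x)⁻¹, by simp [key], fun g hg => ?_⟩
  simp only [key] at hg
  rw [← hg]; simp

/-- The group difference `y x⁻¹` of two points of a fiber: the unique `g ∈ G` with `g x = y`. -/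
def groupDiff (x y : X) : G := (existsUnique_smul_eq E (G := G) x y).choose

theorem groupDiff_smul (x y : X) : groupDiff (G := G) E x y • x = y :=
  (existsUnique_smul_eq E (G := G) x y).choose_spec.1

theorem groupDiff_unique (E : Type*) [NormedAddCommGroup E] [NormedSpace ℝ E]
    {G : Type*} [Group G] [TopologicalSpace G] [ChartedSpace E G]
    {X : Type*} [TopologicalSpace X] [ChartedSpace E X] [MulAction G X] [IsPrincipalFiber E G X]
    {x y : X} {g : G} (h : g • x = y) : g = groupDiff E x y :=
  (existsUnique_smul_eq E (G := G) x y).choose_spec.2 g h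

/-- The gauge difference `x⁻¹ y` of `x ∈ X` and `y ∈ Y`: the `G`-equivariant map `X → Y`,
`x' ↦ (x' x⁻¹) y`, which is the unique one sending `x` to `y`. -/
def gaugeDiff (x : X) (y : Y) : X →[G] Y where
  toFun x' := groupDiff (G := G) E x x' • y
  map_smul' g x' := by
    rw [id, smul_smul, ← groupDiff_unique E (g := g * groupDiff (G := G) E x x')]
    rw [mul_smul, groupDiff_smul]

theorem equivariant_bijective (E : Type*) [NormedAddCommGroup E] [NormedSpace ℝ E]
    {G : Type*} [Group G] [TopologicalSpace G] [ChartedSpace E G]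
    {X Y : Type*} [TopologicalSpace X] [ChartedSpace E X] [MulAction G X] [IsPrincipalFiber E G X]
    [TopologicalSpace Y] [ChartedSpace E Y] [MulAction G Y] [IsPrincipalFiber E G Y]
    (ψ : X →[G] Y) : Function.Bijective ψ := by
  obtain ⟨Φ, -⟩ := IsPrincipalFiber.exists_trivialization (E := E) (G := G) (X := X)
  constructor
  · intro a b h
    have h1 : groupDiff (G := G) E a b • ψ a = ψ a := by
      rw [← map_smul, groupDiff_smul, h]
    have h2 := groupDiff_unique E h1
    rw [← groupDiff_unique E (one_smul G (ψ a))] at h2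
    have h3 := groupDiff_smul (G := G) E a b
    rw [h2, one_smul] at h3
    exact h3
  · intro y
    refine ⟨groupDiff (G := G) E (ψ (Φ 1)) y • Φ 1, ?_⟩
    rw [map_smul, groupDiff_smul]

/-- The inverse `ψ⁻¹` of an equivariant map between fibers. -/
def inv (ψ : X →[G] Y) : Y →[G] X :=
  ψ.inverse (Equiv.ofBijective ψ (equivariant_bijective E ψ)).symm
    (Equiv.ofBijective ψ (equivariant_bijective E ψ)).left_inv
    (Equiv.ofBijective ψ (equivariant_bijective E ψ)).right_inv

theorem apply_inv (ψ : X →[G] Y) (y : Y) : ψ (inv E ψ y) = y :=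
  (Equiv.ofBijective ψ (equivariant_bijective E ψ)).right_inv y

theorem inv_apply (ψ : X →[G] Y) (x : X) : inv E ψ (ψ x) = x :=
  (Equiv.ofBijective ψ (equivariant_bijective E ψ)).left_inv x

end Torsor

/-! ### The adjoint bundle -/

section Adjoint

variable (X : Type*) [TopologicalSpace X] [ChartedSpace E X] [MulAction G X]

/-- The fiber of the adjoint bundle `Ad P = VP/G`: the vector space of `G`-invariant vector
fields on the fiber `X` of `P`. -/
def Ad : Submodule ℝ (∀ x : X, TangentSpace 𝓘(ℝ, E) x) where
  carrier := {A | ∀ (g : G) (x : X),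
    mfderiv 𝓘(ℝ, E) 𝓘(ℝ, E) (fun x' : X => g • x') x (A x) = A (g • x)}
  add_mem' hA hB g x := by
    rw [Pi.add_apply, map_add, hA g x, hB g x, Pi.add_apply]
  zero_mem' g x := by rw [Pi.zero_apply, map_zero, Pi.zero_apply]
  smul_mem' c A hA g x := by
    rw [Pi.smul_apply, map_smul, hA g x, Pi.smul_apply]

/-- The fiber of the coadjoint bundle `Ad* P`. -/
abbrev AdDual := Module.Dual ℝ (Ad E G X)

variable {G X}

variable [LieGroup 𝓘(ℝ, E) ∞ G] [IsPrincipalFiber E G X]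
variable {Y : Type*} [TopologicalSpace Y] [ChartedSpace E Y] [MulAction G Y]
  [IsPrincipalFiber E G Y]

theorem mdifferentiable_equivariant (E : Type*) [NormedAddCommGroup E] [NormedSpace ℝ E]
    {G : Type*} [Group G] [TopologicalSpace G] [ChartedSpace E G]
    [LieGroup 𝓘(ℝ, E) ∞ G]
    {X Y : Type*} [TopologicalSpace X] [ChartedSpace E X] [MulAction G X] [IsPrincipalFiber E G X]
    [TopologicalSpace Y] [ChartedSpace E Y] [MulAction G Y] [IsPrincipalFiber E G Y]
    (ψ : X →[G] Y) :
    MDifferentiable 𝓘(ℝ, E) 𝓘(ℝ, E) ψ := by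
  obtain ⟨Φ, hΦ⟩ := IsPrincipalFiber.exists_trivialization (E := E) (G := G) (X := X)
  obtain ⟨Θ, hΘ⟩ := IsPrincipalFiber.exists_trivialization (E := E) (G := G) (X := Y)
  have h : (ψ : X → Y) = Θ ∘ (fun g => g * Θ.symm (ψ (Φ 1))) ∘ Φ.symm := by
    funext x
    have hx : Φ.symm x • Φ 1 = x := by rw [← hΦ]; simp
    conv_lhs => rw [← hx]
    rw [map_smul]
    simp only [Function.comp_apply, hΘ]
    simp
  rw [h]
  have h2 : ContMDiff 𝓘(ℝ, E) 𝓘(ℝ, E) ∞ (fun g : G => g * Θ.symm (ψ (Φ 1))) :=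
    contMDiff_mul_right
  exact ((Θ.contMDiff_toFun.comp (h2.comp Φ.contMDiff_invFun)).mdifferentiable (by simp))

theorem mdifferentiable_smul (E : Type*) [NormedAddCommGroup E] [NormedSpace ℝ E]
    {G : Type*} [Group G] [TopologicalSpace G] [ChartedSpace E G]
    [LieGroup 𝓘(ℝ, E) ∞ G]
    {X : Type*} [TopologicalSpace X] [ChartedSpace E X] [MulAction G X] [IsPrincipalFiber E G X]
    (g : G) :
    MDifferentiable 𝓘(ℝ, E) 𝓘(ℝ, E) (fun x : X => g • x) := by
  obtain ⟨Φ, hΦ⟩ := IsPrincipalFiber.exists_trivialization (E := E) (G := G) (X := X)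
  have h : (fun x : X => g • x) = Φ ∘ (fun k => g * k) ∘ Φ.symm := by
    funext x
    simp [hΦ]
  rw [h]
  have h2 : ContMDiff 𝓘(ℝ, E) 𝓘(ℝ, E) ∞ (fun k : G => g * k) := contMDiff_mul_left
  exact ((Φ.contMDiff_toFun.comp (h2.comp Φ.contMDiff_invFun)).mdifferentiable (by simp))

/-- The tangent map `T_x X → T_{f x} Y` of `f : X → Y`, with target rewritten along `f x = y`. -/
def mapT {X Y : Type*} [TopologicalSpace X] [ChartedSpace E X] [TopologicalSpace Y]
    [ChartedSpace E Y] (f : X → Y) (x : X) (y : Y) (h : f x = y) :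
    TangentSpace 𝓘(ℝ, E) x →ₗ[ℝ] TangentSpace 𝓘(ℝ, E) y :=
  Eq.rec (motive := fun z _ => TangentSpace 𝓘(ℝ, E) x →ₗ[ℝ] TangentSpace 𝓘(ℝ, E) z)
    (mfderiv 𝓘(ℝ, E) 𝓘(ℝ, E) f x).toLinearMap h

theorem mapT_comp {X Y Z : Type*} [TopologicalSpace X] [ChartedSpace E X] [TopologicalSpace Y]
    [ChartedSpace E Y] [TopologicalSpace Z] [ChartedSpace E Z] {f : X → Y} {f' : Y → Z}
    {k : X → Z} {x : X} {y : Y} {z : Z} (h : f x = y) (h' : f' y = z) (hk : k x = z)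
    (hf : MDifferentiable 𝓘(ℝ, E) 𝓘(ℝ, E) f) (hf' : MDifferentiable 𝓘(ℝ, E) 𝓘(ℝ, E) f')
    (hc : k = f' ∘ f) (w : TangentSpace 𝓘(ℝ, E) x) :
    mapT E f' y z h' (mapT E f x y h w) = mapT E k x z hk w := by
  subst hc h h'
  change mfderiv 𝓘(ℝ, E) 𝓘(ℝ, E) f' (f x) (mfderiv 𝓘(ℝ, E) 𝓘(ℝ, E) f x w) =
    mfderiv 𝓘(ℝ, E) 𝓘(ℝ, E) (f' ∘ f) x w
  rw [mfderiv_comp x (hf' (f x)) (hf x)]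
  rfl

/-- The identification `Ad P_v ≃ T_x P_v` given by the value at `x` of an invariant field. -/
def evalAt (x : X) : Ad E G X ≃ₗ[ℝ] TangentSpace 𝓘(ℝ, E) x where
  toFun A := A.1 x
  map_add' _ _ := rfl
  map_smul' _ _ := rfl
  invFun w := ⟨fun y => mapT E (fun x' : X => groupDiff (G := G) E x y • x') x y
      (groupDiff_smul E x y) w, fun g y =>
    mapT_comp E (f' := fun x' : X => g • x') _ rfl _ (mdifferentiable_smul E _)
      (mdifferentiable_smul E g) (by
        funext x'
        rw [Function.comp_apply, smul_smul]
        congr 1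
        exact (groupDiff_unique E (by rw [mul_smul, groupDiff_smul])).symm) w⟩
  left_inv A := by
    ext y
    have key : ∀ (g : G) (z : X) (h : g • x = z),
        mapT E (fun x' : X => g • x') x z h (A.1 x) = A.1 z := by
      rintro g z rfl
      exact A.2 g x
    exact key _ _ _
  right_inv w := by
    have key : ∀ (g : G) (h : g • x = x), g = 1 →
        mapT E (fun x' : X => g • x') x x h w = w := by
      rintro g h rfl
      have h1 : (fun x' : X => (1 : G) • x') = id := by funext x'; exact one_smul G x'
      have h2 : ∀ (f : X → X) (h : f x = x), f = id → mapT E f x x h w = w := by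
        rintro f h rfl
        change mfderiv 𝓘(ℝ, E) 𝓘(ℝ, E) id x w = w
        rw [mfderiv_id]
        rfl
      exact h2 _ h h1
    exact key _ _ (groupDiff_unique E (one_smul G x)).symm

/-- `Ad_ψ : Ad P_{v₀} → Ad P_{v₁}`, the map induced on invariant vector fields by the
equivariant map `ψ : P_{v₀} → P_{v₁}`: it sends `A` to `y ↦ dψ (A (ψ⁻¹ y))`. -/
def adMap (ψ : X →[G] Y) : Ad E G X →ₗ[ℝ] Ad E G Y where
  toFun A := ⟨fun y => mapT E ψ (inv E ψ y) y (apply_inv E ψ y) (A.1 (inv E ψ y)), by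
    intro g y
    obtain ⟨x, hx⟩ : ∃ x, inv E ψ y = x := ⟨_, rfl⟩
    have hk : ψ (g • x) = g • y := by rw [map_smul, ← hx, apply_inv]
    have h1 : mapT E (fun y' : Y => g • y') y (g • y) rfl
        (mapT E ψ (inv E ψ y) y (apply_inv E ψ y) (A.1 (inv E ψ y))) =
        mapT E (fun x' : X => ψ (g • x')) (inv E ψ y) (g • y) (by rw [hx, hk])
          (A.1 (inv E ψ y)) :=
      mapT_comp E _ _ _ (mdifferentiable_equivariant E ψ) (mdifferentiable_smul E g)
        (by funext x'; exact map_smul ψ g x') _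
    have h2 : ∀ (x x' : X) (h : ψ (g • x) = g • y) (h' : ψ x' = g • y), g • x = x' →
        mapT E (fun x' : X => ψ (g • x')) x (g • y) h (A.1 x) =
          mapT E ψ x' (g • y) h' (A.1 x') := by
      rintro x _ h h' rfl
      rw [← A.2 g x]
      exact (mapT_comp E (f := fun x' : X => g • x') rfl h' h (mdifferentiable_smul E g)
        (mdifferentiable_equivariant E ψ) rfl _).symm
    exact h1.trans (h2 _ _ _ (apply_inv E ψ (g • y)) (map_smul (inv E ψ) g y).symm)⟩
  map_add' A B := by
    ext y
    exact map_add _ _ _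
  map_smul' c A := by
    ext y
    exact map_smul _ _ _

/-- `Ad*_ψ : Ad* P_{v₀} → Ad* P_{v₁}`, the transpose of `Ad_{ψ⁻¹} : Ad P_{v₁} → Ad P_{v₀}`. -/
def coAd (ψ : X →[G] Y) : AdDual E G X →ₗ[ℝ] AdDual E G Y :=
  (adMap E (inv E ψ)).dualMap

end Adjoint

end Fiber

/-! ### Reduced discrete jets and the discrete Euler-Poincaré tensor -/

section Reduced

variable {n : ℕ} {V : Type*} {K : SimplicialComplex n V}
variable (E : Type*) [NormedAddCommGroup E] [NormedSpace ℝ E]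
variable {G : Type*} [Group G] [TopologicalSpace G] [ChartedSpace E G] (H : Subgroup G)
variable (P : V → Type*) [∀ v, TopologicalSpace (P v)] [∀ v, ChartedSpace E (P v)]
  [∀ v, MulAction G (P v)] [∀ v, IsPrincipalFiber E G (P v)]

/-- The fiber `Str_H = P_v / H` of the bundle of `H`-structures. -/
abbrev Str (v : V) : Type _ := MulAction.orbitRel.Quotient H (P v)

/-- The fiber at the facet `β = (v₀, …, vₙ)` of the bundle of `H`-reduced discrete jets, whose
elements `(q₀, ψ₁, …, ψₙ)` consist of an `H`-structure `q₀` at `v₀` and of `G`-equivariant maps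
`ψ_k : P_{v₀} → P_{v_k}`. -/
abbrev RJP (β : Fin (n + 1) → V) : Type _ :=
  Str H P (β 0) × ∀ k : Fin n, P (β 0) →[G] P (β k.succ)

variable {P}

/-- The projection `π^H` from discrete jets to `H`-reduced discrete jets,
`(p₀, …, pₙ) ↦ (H p₀, p₀⁻¹ p₁, …, p₀⁻¹ pₙ)`. -/
def reduce {β : Fin (n + 1) → V} (p : Jet P β) : RJP H P β :=
  (Quotient.mk _ (p 0), fun k => gaugeDiff E (p 0) (p k.succ))

variable (P)

/-- The manifold `P_{v₀} × ∏ₖ (P_{v₀} × P_{v_k})`. The quotient maps `P_{v₀} → P_{v₀} / H` and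
`P_{v₀} × P_{v_k} → (P_{v₀} × P_{v_k}) / G`, `(a, b) ↦ a⁻¹ b`, present the manifold `RJP` as its
quotient by a submersion. -/
abbrev Cover (β : Fin (n + 1) → V) : Type _ :=
  P (β 0) × ∀ k : Fin n, P (β 0) × P (β k.succ)

/-- The model of the manifold `P_{v₀} × ∏ₖ (P_{v₀} × P_{v_k})`. -/
abbrev coverModel (n : ℕ) :=
  𝓘(ℝ, E).prod (ModelWithCorners.pi fun _ : Fin n => 𝓘(ℝ, E).prod 𝓘(ℝ, E))

variable {P}

/-- The quotient map `(p, (a_k, b_k)_k) ↦ (H p, (a_k⁻¹ b_k)_k)` onto the reduced jets. -/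
def coverProj {β : Fin (n + 1) → V} (c : Cover P β) : RJP H P β :=
  (Quotient.mk _ c.1, fun k => gaugeDiff E (c.2 k).1 (c.2 k).2)

variable {H}

/-- A function on reduced jets is smooth (for the quotient manifold structures of
`Str_H = P / H` and `End¹ = (P × P) / G`) if and only if its pullback by the quotient map is. -/
def SmoothReduced {β : Fin (n + 1) → V} (l : RJP H P β → ℝ) : Prop :=
  ContMDiff (coverModel E n) 𝓘(ℝ, ℝ) ∞ (l ∘ coverProj E H)

variable [LieGroup 𝓘(ℝ, E) ∞ G]

/-- The component `∂⁰ l ∈ Ad* P_{v₀}` of `d l` at `r = (q₀, ψ₁, …, ψₙ)`: the image of the partial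
differential of `l` along `Str_H` under the transpose of `Ad P_{v₀} → T_{q₀} Str_H`, the map
sending `A` to the tangent vector at `q₀ = H p` of a curve `H p(t)` with `p(0) = p` and with
velocity `A(p)`. By `partialStr_apply` the choice of the representative `p ∈ q₀` is irrelevant. -/
def partialStr {β : Fin (n + 1) → V} (l : RJP H P β → ℝ) (r : RJP H P β) :
    AdDual E G (P (β 0)) :=
  (mfderiv 𝓘(ℝ, E) 𝓘(ℝ, ℝ) (fun x : P (β 0) => l (Quotient.mk _ x, r.2)) r.1.out).toLinearMap
    ∘ₗ (evalAt E r.1.out).toLinearMap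

/-- The component `∂⁰ⁱ l ∈ Ad* P_{v₀}` of `d l` at `r = (q₀, ψ₁, …, ψₙ)`, for the source
trivialization of the vertical bundle of the `i`-th factor: `A ∈ Ad P_{v₀}` represents the tangent
vector at `ψᵢ = p⁻¹ pᵢ` (with `pᵢ = ψᵢ(p)`) of a curve `p(t)⁻¹ pᵢ` with `p(0) = p` and with
velocity `A(p)`. By `partialEnd_apply` the choice of `p ∈ P_{v₀}` is irrelevant. -/
def partialEnd {β : Fin (n + 1) → V} (l : RJP H P β → ℝ) (r : RJP H P β) (i : Fin n) :
    AdDual E G (P (β 0)) :=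
  (mfderiv 𝓘(ℝ, E) 𝓘(ℝ, ℝ) (fun x : P (β 0) =>
    l (r.1, Function.update r.2 i (gaugeDiff E x (r.2 i r.1.out)))) r.1.out).toLinearMap
    ∘ₗ (evalAt E r.1.out).toLinearMap

theorem mfderiv_invariant (E : Type*) [NormedAddCommGroup E] [NormedSpace ℝ E]
    {G : Type*} [Group G] [TopologicalSpace G] [ChartedSpace E G] [LieGroup 𝓘(ℝ, E) ∞ G]
    {X : Type*} [TopologicalSpace X] [ChartedSpace E X] [MulAction G X] [IsPrincipalFiber E G X]
    (A : Ad E G X) (f f' : X → ℝ) (g : G) (h : ∀ x, f' (g • x) = f x) (x : X) :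
    mfderiv 𝓘(ℝ, E) 𝓘(ℝ, ℝ) f x (A.1 x) =
      (mfderiv 𝓘(ℝ, E) 𝓘(ℝ, ℝ) f' (g • x) (A.1 (g • x)) : ℝ) := by
  have e : f = f' ∘ (fun x => g • x) := by funext x; exact (h x).symm
  have e' : f' = f ∘ (fun x => g⁻¹ • x) := by
    funext x; rw [Function.comp_apply, ← h, smul_inv_smul]
  by_cases hf : MDifferentiableAt 𝓘(ℝ, E) 𝓘(ℝ, ℝ) f' (g • x)
  · have h1 := mfderiv_comp x hf (mdifferentiable_smul E g x)
    rw [← A.2 g x]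
    rw [e, h1]
    rfl
  · have hf' : ¬ MDifferentiableAt 𝓘(ℝ, E) 𝓘(ℝ, ℝ) f x := by
      intro h2
      apply hf
      have h3 : MDifferentiableAt 𝓘(ℝ, E) 𝓘(ℝ, ℝ) f (g⁻¹ • (g • x)) := by
        rwa [inv_smul_smul]
      rw [e']
      exact h3.comp (g • x) (mdifferentiable_smul E g⁻¹ (g • x))
    rw [mfderiv_zero_of_not_mdifferentiableAt hf, mfderiv_zero_of_not_mdifferentiableAt hf']
    rfl

theorem partialStr_apply {β : Fin (n + 1) → V} (l : RJP H P β → ℝ) (r : RJP H P β)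
    (p : P (β 0)) (hp : Quotient.mk _ p = r.1) (A : Ad E G (P (β 0))) :
    partialStr E l r A =
      (mfderiv 𝓘(ℝ, E) 𝓘(ℝ, ℝ) (fun x : P (β 0) => l (Quotient.mk _ x, r.2)) p (A.1 p) : ℝ) := by
  obtain ⟨g, hg⟩ : ∃ g : H, g • r.1.out = p := by
    have h1 : (Quotient.mk _ p : Str H P (β 0)) = Quotient.mk _ r.1.out := by
      rw [hp, Quotient.out_eq]
    exact Quotient.exact h1
  subst hg
  refine mfderiv_invariant E A _ _ (g : G) (fun x => ?_) r.1.out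
  congr 2
  exact Quotient.sound ⟨g, rfl⟩

theorem partialEnd_apply {β : Fin (n + 1) → V} (l : RJP H P β → ℝ) (r : RJP H P β) (i : Fin n)
    (p : P (β 0)) (A : Ad E G (P (β 0))) :
    partialEnd E l r i A =
      (mfderiv 𝓘(ℝ, E) 𝓘(ℝ, ℝ) (fun x : P (β 0) =>
        l (r.1, Function.update r.2 i (gaugeDiff E x (r.2 i p)))) p (A.1 p) : ℝ) := by
  obtain ⟨g, hg⟩ : ∃ g : G, g • r.1.out = p := ⟨_, groupDiff_smul E r.1.out p⟩
  subst hg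
  refine mfderiv_invariant E A _ _ g (fun x => ?_) r.1.out
  congr 3
  ext y
  change groupDiff (G := G) E (g • x) y • r.2 i (g • r.1.out) =
    groupDiff (G := G) E x y • r.2 i r.1.out
  rw [map_smul, smul_smul]
  congr 1
  exact groupDiff_unique E (by rw [mul_smul, groupDiff_smul])

/-- An element of `Ad* P_u` seen in `Ad* P_v` when `u = v`. -/
def atVertex {u v : V} (h : u = v) (θ : AdDual E G (P u)) : AdDual E G (P v) :=
  Eq.rec (motive := fun z _ => AdDual E G (P z)) θ h

/-- The trivialized form in `Ad* P_v` of the discrete Euler-Lagrange tensor, by means of the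
identification `Ad P_v ≃ T_{p_v} P_v`. -/
def trivializedEulerLagrange [K.LocallyFinite] (L : ∀ β : K.facets, Jet P β.1 → ℝ)
    (p : ∀ v, P v) (v : V) : AdDual E G (P v) :=
  eulerLagrange E L p v ∘ₗ (evalAt E (p v)).toLinearMap

end Reduced

end DiscreteField

end

open DiscreteField

open scoped Manifold ContDiff

/-! Smoothness on reduced jets means smoothness after pullback to the cover `P_{v₀} × ∏ₖ (P_{v₀} ×
P_{v_k})`, so every differential is computed there. The map `reduce` factors through the cover by
`(p₀, …, pₙ) ↦ (p₀, (p₀, p_k)_k)`. Let `D` be the differential of the pulled-back function at this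
point (`coverD`).

Moving `p₀` with velocity `A` moves the first slot and the first entry of each pair, giving `D(A,
(A, 0)_k)`. By linearity this is the `∂⁰` term plus the sum of the `∂⁰ⁱ` terms
(`SmoothReduced.partialD_zero`).

Moving `pᵢ` moves only the second entry of the `i`-th pair. With `ψ = p₀⁻¹ pᵢ`, all pairs `(z, ψ z)`
have the same gauge difference `ψ`, so `D` kills the vector `(B, dψ B)` in the `i`-th slot. For `B =
Ad_{ψ⁻¹} A` one has `dψ B = A`. Hence a variation `A` of the second entry counts as minus a
variation `B` of the first, which gives the sign and the `Ad*_ψ` (`SmoothReduced.partialD_succ`).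

It remains to sort the facets around `v` by the position of `v` (`SimplicialComplex.sum_star`). -/

namespace DiscreteField

/-! ### Differentials of maps into finite products of manifolds. -/

section PiManifold

variable {𝕜 : Type*} [NontriviallyNormedField 𝕜]
  {E : Type*} [NormedAddCommGroup E] [NormedSpace 𝕜 E] {H : Type*} [TopologicalSpace H]
  {I : ModelWithCorners 𝕜 E H} {M : Type*} [TopologicalSpace M] [ChartedSpace H M]
  {ι : Type*} [Fintype ι] {F : ι → Type*} [∀ i, NormedAddCommGroup (F i)]
  [∀ i, NormedSpace 𝕜 (F i)] {H' : ι → Type*} [∀ i, TopologicalSpace (H' i)]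
  {J : ∀ i, ModelWithCorners 𝕜 (F i) (H' i)} {N : ι → Type*} [∀ i, TopologicalSpace (N i)]
  [∀ i, ChartedSpace (H' i) (N i)]

/-- A map into a finite product of manifolds is differentiable if its components are, and its
differential has the differentials of the components as components. -/
theorem hasMFDerivAt_pi {f : M → ∀ i, N i} {x : M}
    {f' : ∀ i, TangentSpace I x →L[𝕜] TangentSpace (J i) (f x i)}
    (h : ∀ i, HasMFDerivAt I (J i) (fun y => f y i) x (f' i)) :
    HasMFDerivAt I (ModelWithCorners.pi J) f x
      (ContinuousLinearMap.pi (M := E) (φ := F) f') := by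
  refine ⟨continuousAt_pi.2 fun i => (h i).1, ?_⟩
  exact hasFDerivWithinAt_pi.2 fun i => (h i).2

end PiManifold

/-! ### Splitting the star of a vertex by position. -/

namespace SimplicialComplex

variable {n : ℕ} {V : Type*} {K : SimplicialComplex n V}

theorem eq_position {v : V} (β : K.star v) {i : Fin (n + 1)} (h : β.1.1 i = v) :
    position β = i :=
  K.injective_of_mem _ β.1.2 ((position_spec β).trans h.symm)

/-- The star of `v` is the disjoint union of the sets of facets having `v` at a given position. -/
noncomputable def starEquiv (v : V) : K.star v ≃ Σ i : Fin (n + 1), K.facetsAt i v where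
  toFun β := ⟨position β, β.1, position_spec β⟩
  invFun b := ⟨b.2.1, b.1, b.2.2⟩
  left_inv _ := rfl
  right_inv b := by
    obtain ⟨i, β, h⟩ := b
    -- `position` is an opaque choice, so the index is generalized before the equality of positions
    -- is substituted into the dependent pair.
    have key : ∀ j (hj : β.1 j = v), j = i →
        (⟨j, β, hj⟩ : Σ i : Fin (n + 1), K.facetsAt i v) = ⟨i, β, h⟩ := by
      rintro _ _ rfl
      rfl
    exact key _ _ (eq_position ⟨β, i, h⟩ h)

/-- The summand takes the proof of `β.1 i = v` as an argument because the Euler-Lagrange terms are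
transported along it. -/
theorem sum_star [K.LocallyFinite] {M : Type*} [AddCommMonoid M] (v : V)
    (f : ∀ (β : K.facets) (i : Fin (n + 1)), β.1 i = v → M) :
    ∑ β : K.star v, f β.1 (position β) (position_spec β) =
      ∑ i, ∑ β : K.facetsAt i v, f β.1 i β.2 := by
  rw [← Fintype.sum_sigma' (fun i (β : K.facetsAt i v) => f β.1 i β.2)]
  exact Fintype.sum_equiv (starEquiv v) _ _ fun _ => rfl

end SimplicialComplex

/-! ### Gauge differences and invariant fields. -/

section Fiber

variable (E : Type*) [NormedAddCommGroup E] [NormedSpace ℝ E]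
  {G : Type*} [Group G] [TopologicalSpace G] [ChartedSpace E G]
  {X Y : Type*}
  [TopologicalSpace X] [ChartedSpace E X] [MulAction G X] [IsPrincipalFiber E G X]
  [TopologicalSpace Y] [ChartedSpace E Y] [MulAction G Y] [IsPrincipalFiber E G Y]

omit [TopologicalSpace Y] [ChartedSpace E Y] [IsPrincipalFiber E G Y] in
theorem gaugeDiff_apply_self (x : X) (y : Y) : gaugeDiff (G := G) E x y x = y := by
  change groupDiff (G := G) E x x • y = y
  rw [← groupDiff_unique E (one_smul G x), one_smul]

omit [TopologicalSpace Y] [ChartedSpace E Y] [IsPrincipalFiber E G Y] in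
-- An equivariant map out of a fiber is determined by its value at one point. Consequently the graph
-- of `ψ` lies over a single point of the quotient `(X × Y)/G`.
theorem gaugeDiff_apply (ψ : X →[G] Y) (x : X) : gaugeDiff E x (ψ x) = ψ := by
  ext z
  change groupDiff (G := G) E x z • ψ x = ψ z
  rw [← map_smul, groupDiff_smul]

variable [LieGroup 𝓘(ℝ, E) ∞ G]

/-- Chain rule for `ψ ∘ ψ⁻¹ = id`, applied to the value of `A` at `ψ x`. -/
theorem mfderiv_adMap_inv (ψ : X →[G] Y) (x : X) (A : Ad E G Y) :
    mfderiv 𝓘(ℝ, E) 𝓘(ℝ, E) ψ x ((adMap E (inv E ψ) A).1 x) = A.1 (ψ x) := by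
  -- By definition `adMap` evaluates `A` at `inv E (inv E ψ) x`, which equals `ψ x` only
  -- propositionally; hence a variable base point `y`.
  have key : ∀ (y : Y) (hy : y = ψ x) (h : inv E ψ y = x),
      mapT E ψ x (ψ x) rfl (mapT E (inv E ψ) y x h (A.1 y)) = A.1 (ψ x) := by
    rintro _ rfl h
    have hid : (id : Y → Y) = ψ ∘ inv E ψ := by
      funext z
      exact (apply_inv E ψ z).symm
    rw [mapT_comp E h rfl rfl (mdifferentiable_equivariant E _)
      (mdifferentiable_equivariant E _) hid]
    change mfderiv 𝓘(ℝ, E) 𝓘(ℝ, E) id (ψ x) (A.1 (ψ x)) = _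
    rw [mfderiv_id]
    rfl
  refine key _ ?_ _
  rw [← apply_inv E ψ (inv E (inv E ψ) x)]
  exact congrArg ψ (apply_inv E (inv E ψ) x)

end Fiber

/-! ### Pullback of reduced functions to the cover. -/

section Reduced

variable {n : ℕ} {V : Type*} {K : SimplicialComplex n V}
  {E : Type*} [NormedAddCommGroup E] [NormedSpace ℝ E]
  {G : Type*} [Group G] [TopologicalSpace G] [ChartedSpace E G] {H : Subgroup G}
  {P : V → Type*} [∀ v, TopologicalSpace (P v)] [∀ v, ChartedSpace E (P v)]
  [∀ v, MulAction G (P v)] [∀ v, IsPrincipalFiber E G (P v)]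
  {β : Fin (n + 1) → V}

omit [∀ v, MulAction G (P v)] [∀ v, IsPrincipalFiber E G (P v)] in
theorem partialD_eq (L : Jet P β → ℝ) (y : Jet P β) (k : Fin (n + 1)) {g : P (β k) → ℝ}
    (h : ∀ x, L (Function.update y k x) = g x) (w : TangentSpace 𝓘(ℝ, E) (y k)) :
    partialD E L y k w = (mfderiv 𝓘(ℝ, E) 𝓘(ℝ, ℝ) g (y k) w : ℝ) := by
  obtain rfl : (fun x => L (Function.update y k x)) = g := funext h
  rfl

theorem reduce_update_zero (y : Jet P β) (x : P (β 0)) :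
    reduce E H (Function.update y 0 x) = coverProj E H (x, fun k => (x, y k.succ)) := by
  simp [reduce, coverProj]

theorem reduce_update_succ (y : Jet P β) (i : Fin n) (x : P (β i.succ)) :
    reduce E H (Function.update y i.succ x) =
      coverProj E H (y 0, Function.update (fun k => (y 0, y k.succ)) i (y 0, x)) := by
  have h0 : Function.update y i.succ x 0 = y 0 :=
    Function.update_of_ne (Fin.succ_ne_zero i).symm _ _
  refine Prod.ext ?_ (funext fun k => ?_)
  · simp [reduce, coverProj, h0]
  · by_cases hk : k = i
    · subst hk
      simp [reduce, coverProj, h0]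
    · simp [reduce, coverProj, h0, hk]

/-- The point over `reduce E H y` in the covering manifold of the reduced jets. -/
def toCover (y : Jet P β) : Cover P β := (y 0, fun k => (y 0, y k.succ))

variable (E) in
/-- The differential at a jet of the pullback of a function on reduced jets. -/
noncomputable def coverD (l : RJP H P β → ℝ) (y : Jet P β) : (E × (Fin n → E × E)) →L[ℝ] ℝ :=
  mfderiv (coverModel E n) 𝓘(ℝ, ℝ) (l ∘ coverProj E H) (toCover y)

/-- The chain rule through the cover. Writing the result with `coverD` on the fixed model space lets
contributions of different curves through `toCover y` be added by linearity. -/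
theorem SmoothReduced.mfderiv_comp {l : RJP H P β → ℝ} (hl : SmoothReduced E l) (y : Jet P β)
    {X : Type*} [TopologicalSpace X] [ChartedSpace E X] {x : X}
    {a : X → P (β 0)} {b : ∀ k : Fin n, X → P (β 0) × P (β k.succ)}
    {a' : E →L[ℝ] E} {b' : Fin n → E →L[ℝ] E × E}
    (ha : HasMFDerivAt 𝓘(ℝ, E) 𝓘(ℝ, E) a x a')
    (hb : ∀ k, HasMFDerivAt 𝓘(ℝ, E) (𝓘(ℝ, E).prod 𝓘(ℝ, E)) (b k) x (b' k))
    (hxa : a x = y 0) (hxb : ∀ k, b k x = (y 0, y k.succ)) (w : TangentSpace 𝓘(ℝ, E) x) :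
    mfderiv 𝓘(ℝ, E) 𝓘(ℝ, ℝ) (fun z => l (coverProj E H (a z, fun k => b k z))) x w =
      coverD E l y (a' w, fun k => b' k w) := by
  have h : (a x, fun k => b k x) = toCover y := Prod.ext hxa (funext hxb)
  have hd := (hl.mdifferentiable (by simp) (a x, fun k => b k x)).hasMFDerivAt
  have hc := HasMFDerivAt.comp x hd (ha.prodMk (hasMFDerivAt_pi (f := fun z k => b k z) hb))
  rw [coverD, ← h]
  exact DFunLike.congr_fun hc.mfderiv w

theorem SmoothReduced.mfderiv_update {l : RJP H P β → ℝ} (hl : SmoothReduced E l) (y : Jet P β)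
    (i : Fin n) {X : Type*} [TopologicalSpace X] [ChartedSpace E X] {x : X}
    {f : X → P (β 0) × P (β i.succ)} {f' : E →L[ℝ] E × E}
    (hf : HasMFDerivAt 𝓘(ℝ, E) (𝓘(ℝ, E).prod 𝓘(ℝ, E)) f x f')
    (hx : f x = (y 0, y i.succ)) (w : TangentSpace 𝓘(ℝ, E) x) :
    mfderiv 𝓘(ℝ, E) 𝓘(ℝ, ℝ) (fun z => l (coverProj E H
        (y 0, Function.update (fun k => (y 0, y k.succ)) i (f z)))) x w =
      coverD E l y (0, Pi.single i (f' w)) := by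
  have h := hl.mfderiv_comp y (x := x) (a := fun _ => y 0) (a' := 0)
    (b := fun k z => Function.update (fun k : Fin n => (y 0, y k.succ)) i (f z) k)
    -- All pairs but the `i`-th are constant, so their derivatives vanish.
    (b' := Function.update (fun _ => (0 : E →L[ℝ] E × E)) i f')
    (hasMFDerivAt_const _ _) (fun k => ?_) rfl (fun k => ?_) w
  · refine h.trans (congrArg (coverD E l y) (Prod.ext rfl (funext fun k => ?_)))
    by_cases hk : k = i
    · subst hk
      simp
    · simp only [Function.update_of_ne hk, Pi.single_eq_of_ne hk]
      rfl
  · by_cases hk : k = i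
    · subst hk
      rw [Function.update_self]
      exact hf.congr_of_eventuallyEq (.of_forall fun z => by simp)
    · rw [Function.update_of_ne hk]
      exact (hasMFDerivAt_const (y 0, y k.succ) x).congr_of_eventuallyEq
        (.of_forall fun z => by simp [hk])
  · by_cases hk : k = i
    · subst hk
      simpa using hx
    · simp [hk]

/-! ### The components of the differential and the partial differentials, in terms of `coverD`. -/

variable [LieGroup 𝓘(ℝ, E) ∞ G]

/-- The representative of the `H`-structure is free, so it can be taken to be `y 0`; the pairs stay
fixed. -/
theorem SmoothReduced.partialStr_reduce {l : RJP H P β → ℝ} (hl : SmoothReduced E l)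
    (y : Jet P β) (A : Ad E G (P (β 0))) :
    partialStr E l (reduce E H y) A = coverD E l y (A.1 (y 0), 0) :=
  (partialStr_apply E l (reduce E H y) (y 0) rfl A).trans
    (hl.mfderiv_comp y (b := fun k _ => (y 0, y k.succ)) (b' := fun _ => 0) (hasMFDerivAt_id _)
      (fun _ => hasMFDerivAt_const _ _) rfl (fun _ => rfl) _)

/-- With base point `y 0`, the curve `p(t)⁻¹ ψᵢ(p)` lifts to the pair `(p(t), y i.succ)`. -/
theorem SmoothReduced.partialEnd_reduce {l : RJP H P β → ℝ} (hl : SmoothReduced E l)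
    (y : Jet P β) (i : Fin n) (A : Ad E G (P (β 0))) :
    partialEnd E l (reduce E H y) i A =
      coverD E l y (0, Pi.single i (A.1 (y 0), 0)) := by
  rw [partialEnd_apply E l (reduce E H y) i (y 0) A]
  have h := hl.mfderiv_update y i (x := y 0) (f := fun z => (z, y i.succ))
    ((hasMFDerivAt_id _).prodMk (hasMFDerivAt_const _ _)) rfl (A.1 (y 0))
  refine Eq.trans ?_ h
  congr 2
  funext x
  congr 1
  refine Prod.ext rfl (funext fun k => ?_)
  change Function.update (fun k : Fin n => gaugeDiff (G := G) E (y 0) (y k.succ)) i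
    (gaugeDiff E x (gaugeDiff (G := G) E (y 0) (y i.succ) (y 0))) k = _
  rw [gaugeDiff_apply_self]
  by_cases hk : k = i
  · subst hk
    simp [coverProj]
  · simp [coverProj, hk]

theorem SmoothReduced.partialD_zero {l : RJP H P β → ℝ} (hl : SmoothReduced E l) (y : Jet P β)
    (A : Ad E G (P (β 0))) :
    partialD E (l ∘ reduce E H) y 0 (A.1 (y 0)) =
      partialStr E l (reduce E H y) A + ∑ i, partialEnd E l (reduce E H y) i A := by
  have h := hl.mfderiv_comp y (b := fun k z => (z, y k.succ)) (hasMFDerivAt_id _)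
    (fun _ => (hasMFDerivAt_id _).prodMk (hasMFDerivAt_const _ _)) rfl (fun _ => rfl) (A.1 (y 0))
  have h' : partialD E (l ∘ reduce E H) y 0 (A.1 (y 0)) =
      coverD E l y (A.1 (y 0), fun _ => (A.1 (y 0), 0)) := by
    exact (partialD_eq _ y 0 (fun x => congrArg l (reduce_update_zero y x)) _).trans h
  simp only [h', hl.partialStr_reduce, hl.partialEnd_reduce]
  rw [← map_sum, ← map_add]
  congr 1
  refine Prod.ext ?_ ?_
  · simp only [Prod.fst_add, Prod.fst_sum, Finset.sum_const_zero]
    exact (add_zero (A.1 (y 0) : E)).symm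
  · simp only [Prod.snd_add, Prod.snd_sum, zero_add]
    exact (Finset.univ_sum_single (fun _ : Fin n => ((A.1 (y 0), 0) : E × E))).symm

theorem SmoothReduced.partialD_succ {l : RJP H P β → ℝ} (hl : SmoothReduced E l) (y : Jet P β)
    (i : Fin n) (A : Ad E G (P (β i.succ))) :
    partialD E (l ∘ reduce E H) y i.succ (A.1 (y i.succ)) =
      -coAd E ((reduce E H y).2 i) (partialEnd E l (reduce E H y) i) A := by
  have h1 : partialD E (l ∘ reduce E H) y i.succ (A.1 (y i.succ)) =
      coverD E l y (0, Pi.single i (0, A.1 (y i.succ))) := by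
    have h := hl.mfderiv_update y i (x := y i.succ) (f := fun z => (y 0, z))
      ((hasMFDerivAt_const _ _).prodMk (hasMFDerivAt_id _)) rfl (A.1 (y i.succ))
    exact (partialD_eq _ y i.succ (fun x => congrArg l (reduce_update_succ y i x)) _).trans h
  obtain ⟨ψ, hψ⟩ : ∃ ψ, gaugeDiff (G := G) E (y 0) (y i.succ) = ψ := ⟨_, rfl⟩
  have hy : ψ (y 0) = y i.succ := by rw [← hψ, gaugeDiff_apply_self]
  have hr : (reduce E H y).2 i = ψ := hψ
  have h2 : coAd E ψ (partialEnd E l (reduce E H y) i) A =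
      coverD E l y (0, Pi.single i ((adMap E (inv E ψ) A).1 (y 0), 0)) :=
    hl.partialEnd_reduce y i _
  have h3 : mfderiv 𝓘(ℝ, E) 𝓘(ℝ, E) ψ (y 0) ((adMap E (inv E ψ) A).1 (y 0)) =
      (A.1 (y i.succ) : E) := by
    rw [mfderiv_adMap_inv]
    exact congrArg (fun z => (A.1 z : E)) hy
  -- Differentiation along the graph of `ψ`, on which the function is constant by `h5`. The
  -- resulting vanishing of `coverD` exchanges the two entries of the `i`-th pair up to sign.
  have h4 := hl.mfderiv_update y i (x := y 0) (f := fun z => (z, ψ z))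
    ((hasMFDerivAt_id _).prodMk ((mdifferentiable_equivariant E ψ _).hasMFDerivAt))
    (by rw [hy]) ((adMap E (inv E ψ) A).1 (y 0))
  have h5 : (fun z => l (coverProj E H
      (y 0, Function.update (fun k => (y 0, y k.succ)) i (z, ψ z)))) =
      fun _ => l (reduce E H y) := by
    funext z
    congr 1
    refine Prod.ext rfl (funext fun k => ?_)
    by_cases hk : k = i
    · subst hk
      simp [coverProj, gaugeDiff_apply, hr]
    · simp [coverProj, reduce, hk]
  rw [h5, mfderiv_const] at h4
  rw [hr, h1, h2, eq_neg_iff_add_eq_zero, ← map_add]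
  refine Eq.trans ?_ h4.symm
  congr 1
  refine Prod.ext (add_zero _) ?_
  refine (Pi.single_add _ _ _).symm.trans (congrArg _ ?_)
  refine Prod.ext (zero_add _) ?_
  exact (add_zero _).trans h3.symm

end Reduced

end DiscreteField

/-! ### Summation over the star of a vertex. -/

theorem mainTheorem2
    {E : Type*} [NormedAddCommGroup E] [NormedSpace ℝ E] [FiniteDimensional ℝ E]
    {G : Type*} [Group G] [TopologicalSpace G] [ChartedSpace E G] [LieGroup 𝓘(ℝ, E) ∞ G]
    {V : Type*} {P : V → Type*} [∀ v, TopologicalSpace (P v)] [∀ v, ChartedSpace E (P v)]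
    [∀ v, IsManifold 𝓘(ℝ, E) ∞ (P v)] [∀ v, MulAction G (P v)] [∀ v, IsPrincipalFiber E G (P v)]
    {n : ℕ} (K : SimplicialComplex n V) [K.LocallyFinite]
    (H : Subgroup G) (hH : IsClosed (H : Set G))
    (l : ∀ β : K.facets, RJP H P β.1 → ℝ) (hl : ∀ β, SmoothReduced E (l β))
    (L : ∀ β : K.facets, Jet P β.1 → ℝ) (hL : ∀ β, L β = l β ∘ reduce E H)
    (p : ∀ v, P v) (v : V) :
    trivializedEulerLagrange E L p v =
      ∑ β : K.facetsAt 0 v,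
        atVertex E β.2 (partialStr E (l β.1) (reduce E H (jetExt p β.1.1)))
      + ∑ i : Fin n, ∑ β : K.facetsAt 0 v,
        atVertex E β.2 (partialEnd E (l β.1) (reduce E H (jetExt p β.1.1)) i)
      - ∑ i : Fin n, ∑ β : K.facetsAt i.succ v,
        atVertex E β.2 (coAd E ((reduce E H (jetExt p β.1.1)).2 i)
          (partialEnd E (l β.1) (reduce E H (jetExt p β.1.1)) i)) := by
  -- Leaving `v` free up to a proof of `β.1 i = v` lets substitution remove every transport at once;
  -- the case split on `i` then selects `partialD_zero` or `partialD_succ`.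
  have hterm : ∀ (β : K.facets) (i : Fin (n + 1)) (h : β.1 i = v) (A : Ad E G (P v)),
      (Eq.rec (motive := fun u _ => TangentSpace 𝓘(ℝ, E) (p u) →ₗ[ℝ] ℝ)
        (partialD E (L β) (jetExt p β.1) i) h : TangentSpace 𝓘(ℝ, E) (p v) →ₗ[ℝ] ℝ) (A.1 (p v)) =
      Fin.cases (motive := fun i => β.1 i = v → ℝ)
        (fun h => atVertex E h (partialStr E (l β) (reduce E H (jetExt p β.1))) A +
          ∑ i, atVertex E h (partialEnd E (l β) (reduce E H (jetExt p β.1)) i) A)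
        (fun i h => -atVertex E h (coAd E ((reduce E H (jetExt p β.1)).2 i)
          (partialEnd E (l β) (reduce E H (jetExt p β.1)) i)) A) i h := by
    rintro β i rfl A
    rw [hL β]
    induction i using Fin.cases with
    | zero => exact (hl β).partialD_zero (jetExt p β.1) A
    | succ i => exact (hl β).partialD_succ (jetExt p β.1) i A
  ext A
  have hsum : trivializedEulerLagrange E L p v A = ∑ i, ∑ β : K.facetsAt i v,
      Fin.cases (motive := fun i => β.1.1 i = v → ℝ)
        (fun h => atVertex E h (partialStr E (l β.1) (reduce E H (jetExt p β.1.1))) A +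
          ∑ i, atVertex E h (partialEnd E (l β.1) (reduce E H (jetExt p β.1.1)) i) A)
        (fun i h => -atVertex E h (coAd E ((reduce E H (jetExt p β.1.1)).2 i)
          (partialEnd E (l β.1) (reduce E H (jetExt p β.1.1)) i)) A) i β.2 := by
    rw [← SimplicialComplex.sum_star v (fun β i h => Fin.cases (motive := fun i => β.1 i = v → ℝ)
        (fun h => atVertex E h (partialStr E (l β) (reduce E H (jetExt p β.1))) A +
          ∑ i, atVertex E h (partialEnd E (l β) (reduce E H (jetExt p β.1)) i) A)
        (fun i h => -atVertex E h (coAd E ((reduce E H (jetExt p β.1)).2 i)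
          (partialEnd E (l β) (reduce E H (jetExt p β.1)) i)) A) i h)]
    change eulerLagrange E L p v (A.1 (p v)) = _
    rw [eulerLagrange, LinearMap.sum_apply]
    exact Finset.sum_congr rfl fun β _ => hterm _ _ _ A
  rw [hsum, Fin.sum_univ_succ]
  simp only [Fin.cases_zero, Fin.cases_succ, Finset.sum_add_distrib, Finset.sum_neg_distrib,
    LinearMap.sub_apply, LinearMap.add_apply, LinearMap.sum_apply, ← sub_eq_add_neg]
  -- In the position-zero part the sum over `i` still sits inside the sum over facets.
  rw [Finset.sum_comm]
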